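/- Let $p>1$. For every measurable function $f:[1,\infty)\to[0,\infty)$, $$\sum_{n=1}^{\infty}\left(\frac1n\int_1^n f(t)\,dt\right)^p\le\left(\frac{p}{p-1}\right)^p\int_1^{\infty}f(x)^p\,dx ,$$ where both sides take values in $[0,\infty]$. Let $1<p\le q<\infty$. Then there is a least constant $A\in[0,\infty)$ such that $$\left[\int_1^{\infty}\left(\frac1x\sum_{1\le n<x}f(n)\right)^q dx\right]^{1/q}\le A\left[\sum_{n=1}^{\infty}f(n)^p\right]^{1/p}$$ holds for every sequence $(f(n))_{n\ge1}$ of non-negative reals (both sides in $[0,\infty]$), and it satisfies $$(q-1)^{-1/q}\le A\le k_{q,p}\,(q-1)^{-1/q}.$$ Here, for $p<q$, with $r=q/p-1$ and $B(a,b)=\int_0^1x^{a-1}(1-x)^{b-1}\,dx$, $$k_{q,p}=\left(\frac{r}{B(1/r,(q-1)/r)}\right)^{1/p-1/q},$$ and for $p=q$, $k_{p,p}=p^{1/p}(p^*)^{1/p^*}$ with $p^*=p/(p-1)$. -/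

import Mathlib

open MeasureTheory Set
open scoped NNReal ENNReal

/-- Euler's beta function `B(a, b) = ∫₀¹ x ^ (a - 1) (1 - x) ^ (b - 1) dx`, used for `a, b > 0`. -/
noncomputable def eulerBeta (a b : ℝ) : ℝ :=
  ∫ x in (0 : ℝ)..1, x ^ (a - 1) * (1 - x) ^ (b - 1)

/-- The factor `k_{q,p} = (r / B(1/r, (q-1)/r)) ^ (1/p - 1/q)` with `r = q/p - 1` for `p < q`.
At `p = q` this expression is undefined, and `k_{p,p} = p ^ (1/p) * (p*) ^ (1/p*)`, where
`p* = p / (p - 1)`, is its limit as `q` decreases to `p`. -/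
noncomputable def hardyFactor (q p : ℝ) : ℝ :=
  if p = q then
    p ^ (1 / p) * (p / (p - 1)) ^ (1 - 1 / p)
  else
    ((q / p - 1) / eulerBeta (1 / (q / p - 1)) ((q - 1) / (q / p - 1))) ^ (1 / p - 1 / q)

/-- The constants `A ≥ 0` such that
`(∫₁^∞ ((1/x) ∑_{1 ≤ n < x} f n) ^ q dx) ^ (1/q) ≤ A (∑_{n ≥ 1} (f n) ^ p) ^ (1/p)` for every
non-negative sequence `f`, both sides being read in `[0, ∞]`.
For `n : ℕ`, `n < ⌈x⌉₊` is the same as `n < x`. -/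
def mixedHardyConstants (p q : ℝ) : Set ℝ≥0 :=
  {A | ∀ f : ℕ → ℝ≥0,
    (∫⁻ x in Ioi (1 : ℝ),
        ((ENNReal.ofReal x)⁻¹ * ∑ n ∈ Finset.Ico 1 ⌈x⌉₊, (f n : ℝ≥0∞)) ^ q) ^ (1 / q)
      ≤ (A : ℝ≥0∞) * (∑' n : ℕ, (f (n + 1) : ℝ≥0∞) ^ p) ^ (1 / p)}

/-
For `p = q` the left side is dominated by Hardy's series, and Hardy's inequality for series follows
by adding the tangent line inequalities of `t ↦ t ^ p` at the successive means: they telescope.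

For `p < q` the sums are integrals of a step function, and the estimate comes from Bliss's
inequality. Let `F x = ∫₀ˣ f` and `u = F ^ p * x ^ (1 - p)`. For every continuous `ζ ≥ 0` the
tangent line inequality gives
  `f ^ p ≥ ζ(u) u' + (p - 1) (ζ(u) - ζ(u) ^ (p / (p - 1))) u / x`,
whose first term on the right is exact. If `ζ - ζ ^ (p / (p - 1)) = (u / s) ^ r`, the second term is
a multiple of the integrand `u ^ (1 + r) / x` of Bliss's inequality. This equation has two roots.
With the larger one before the maximum of `u` and the smaller one after it, the exact terms add up
to `s` times the area under `c ↦ (c - c ^ (p / (p - 1))) ^ (1 / r)`, a beta integral, and the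
weighted inequality of arithmetic and geometric means eliminates `s`.

Bliss's inequality has the weight `x ^ (r - q)` on `(0, ∞)`. Since the sum over `n < x` increases
with `x` and vanishes for `x ≤ 1`, a change of variables compares it with the weight `x ^ (-q)` on
`(1, ∞)`.
-/

theorem absolutelyContinuousOnInterval_comp_of_lipschitzOnWith {φ u : ℝ → ℝ} {s : Set ℝ}
    {K : ℝ≥0} {a b : ℝ} (hφ : LipschitzOnWith K φ s) (hu : AbsolutelyContinuousOnInterval u a b)
    (hus : MapsTo u (uIcc a b) s) :
    AbsolutelyContinuousOnInterval (fun x => φ (u x)) a b := by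
  refine squeeze_zero' (.of_forall fun _ => Finset.sum_nonneg fun _ _ => dist_nonneg) ?_
    (by simpa using Filter.Tendsto.const_mul (K : ℝ) hu)
  rw [Filter.eventually_inf_principal]
  refine .of_forall fun E hE => ?_
  rw [Finset.mul_sum]
  exact Finset.sum_le_sum fun i hi =>
    hφ.dist_le_mul _ (hus (hE.1 i hi).1) _ (hus (hE.1 i hi).2)

theorem absolutelyContinuousOnInterval_comp_of_contDiff {φ u : ℝ → ℝ} {a b : ℝ}
    (hφ : ContDiff ℝ 1 φ) (hu : AbsolutelyContinuousOnInterval u a b) :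
    AbsolutelyContinuousOnInterval (fun x => φ (u x)) a b := by
  obtain ⟨M, hM⟩ := hu.exists_bound
  obtain ⟨K, hK⟩ := hφ.contDiffOn.exists_lipschitzOnWith (s := Icc (-M) M) one_ne_zero
    (convex_Icc _ _) isCompact_Icc
  exact absolutelyContinuousOnInterval_comp_of_lipschitzOnWith hK hu fun x hx => abs_le.1 (hM x hx)

theorem contDiff_one_integral {ζ : ℝ → ℝ} (hζ : Continuous ζ) :
    ContDiff ℝ 1 fun y => ∫ t in (0 : ℝ)..y, ζ t := by
  have hderiv : deriv (fun y => ∫ t in (0 : ℝ)..y, ζ t) = ζ :=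
    funext (hζ.deriv_integral ζ 0)
  rw [contDiff_one_iff_deriv, hderiv]
  exact ⟨fun y => (hζ.integral_hasStrictDerivAt 0 y).hasDerivAt.differentiableAt, hζ⟩

theorem tangent_le_rpow {p x y : ℝ} (hp : 1 < p) (hx : 0 ≤ x) (hy : 0 ≤ y) :
    p * y ^ (p - 1) * x - (p - 1) * y ^ p ≤ x ^ p := by
  have hpq := Real.HolderConjugate.conjExponent hp
  have hyoung := Real.young_inequality_of_nonneg hx (Real.rpow_nonneg hy (p - 1)) hpq
  rw [← Real.rpow_mul hy, hpq.sub_one_mul_conj] at hyoung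
  have h := mul_le_mul_of_nonneg_left hyoung hpq.nonneg
  have hp0 : p ≠ 0 := hpq.ne_zero
  have : p * (y ^ p / p.conjExponent) = (p - 1) * y ^ p := by
    rw [Real.conjExponent]; field_simp
  rw [mul_add, this, mul_div_cancel₀ _ hp0] at h
  linarith

theorem mul_rpow_le_add_rpow {r x y : ℝ} (hr : 0 < r) (hx : 0 ≤ x) (hy : 0 ≤ y) :
    (1 + r) * x * ((1 + r) * y / r) ^ r ≤ (x + y) ^ (1 + r) := by
  have hr1 : 0 < 1 + r := by linarith
  have hgeom := Real.geom_mean_le_arith_mean2_weighted (one_div_nonneg.2 hr1.le)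
    (div_nonneg hr.le hr1.le) (mul_nonneg hr1.le hx) (div_nonneg (mul_nonneg hr1.le hy) hr.le)
    (by field_simp)
  have hsum : 1 / (1 + r) * ((1 + r) * x) + r / (1 + r) * ((1 + r) * y / r) = x + y := by field_simp
  have hpow := Real.rpow_le_rpow (by positivity) (hgeom.trans_eq hsum) hr1.le
  rwa [Real.mul_rpow (by positivity) (by positivity), ← Real.rpow_mul (by positivity),
    ← Real.rpow_mul (by positivity), one_div_mul_cancel hr1.ne', div_mul_cancel₀ _ hr1.ne',
    Real.rpow_one] at hpow

theorem one_lt_div_sub_one {p : ℝ} (hp : 1 < p) : 1 < p / (p - 1) := by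
  rw [one_lt_div] <;> linarith

theorem sub_rpow_nonneg {c s : ℝ} (hs : 1 ≤ s) (hc : c ∈ Icc (0 : ℝ) 1) : 0 ≤ c - c ^ s :=
  sub_nonneg.2 (Real.rpow_le_self_of_le_one hc.1 hc.2 hs)

theorem strictConcaveOn_sub_rpow {s : ℝ} (hs : 1 < s) :
    StrictConcaveOn ℝ (Icc 0 1) fun c : ℝ => c - c ^ s :=
  (concaveOn_id (convex_Icc 0 1)).sub_strictConvexOn
    ((strictConvexOn_rpow hs).subset (fun _ hx => hx.1) (convex_Icc 0 1))

theorem ofReal_inv_rpow {x : ℝ} (hx : 0 < x) (q : ℝ) :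
    (ENNReal.ofReal x)⁻¹ ^ q = ENNReal.ofReal (x ^ (-q)) := by
  rw [ENNReal.inv_rpow, ENNReal.ofReal_rpow_of_pos hx, Real.rpow_neg hx.le,
    ENNReal.ofReal_inv_of_pos (by positivity)]

/-! ### Euler's beta function -/

theorem eulerBeta_eq_beta {a b : ℝ} (ha : 0 < a) (hb : 0 < b) :
    eulerBeta a b = ProbabilityTheory.beta a b := by
  have hcast : Complex.betaIntegral a b = (eulerBeta a b : ℂ) := by
    rw [eulerBeta, Complex.betaIntegral, ← intervalIntegral.integral_ofReal]
    refine intervalIntegral.integral_congr fun x hx => ?_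
    rw [uIcc_of_le zero_le_one] at hx
    simp only [Complex.ofReal_mul, Complex.ofReal_cpow hx.1,
      Complex.ofReal_cpow (sub_nonneg.2 hx.2), Complex.ofReal_sub, Complex.ofReal_one]
  rw [ProbabilityTheory.beta_eq_betaIntegralReal a b ha hb, hcast, Complex.ofReal_re]

theorem eulerBeta_pos {a b : ℝ} (ha : 0 < a) (hb : 0 < b) : 0 < eulerBeta a b :=
  eulerBeta_eq_beta ha hb ▸ ProbabilityTheory.beta_pos ha hb

theorem mul_eulerBeta_add_one_symm {a b : ℝ} (ha : 0 < a) (hb : 0 < b) :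
    b * eulerBeta b (a + 1) = a * eulerBeta a (b + 1) := by
  rw [eulerBeta_eq_beta hb (by positivity), eulerBeta_eq_beta ha (by positivity),
    ProbabilityTheory.beta, ProbabilityTheory.beta, Real.Gamma_add_one ha.ne',
    Real.Gamma_add_one hb.ne']
  ring_nf

theorem integral_zero_one_comp_rpow {s : ℝ} (hs : 0 < s) (g : ℝ → ℝ) :
    ∫ c in (0 : ℝ)..1, g c = ∫ x in (0 : ℝ)..1, s * x ^ (s - 1) * g (x ^ s) := by
  have hmem {x : ℝ} (hx : x ∈ Ioi (0 : ℝ)) : x ^ s ∈ Iic (1 : ℝ) ↔ x ∈ Iic (1 : ℝ) := by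
    simpa only [mem_Iic, Real.one_rpow] using Real.rpow_le_rpow_iff (le_of_lt hx) zero_le_one hs
  rw [intervalIntegral.integral_of_le zero_le_one, intervalIntegral.integral_of_le zero_le_one,
    ← Ioi_inter_Iic, ← setIntegral_indicator measurableSet_Iic,
    ← setIntegral_indicator measurableSet_Iic, ← integral_comp_rpow_Ioi_of_pos hs]
  refine setIntegral_congr_fun measurableSet_Ioi fun x hx => ?_
  simp only [indicator, smul_eq_mul, hmem hx, mul_ite, mul_zero]

/-! ### Hardy's inequality -/

theorem lintegral_Ioc_eq_sum {u : ℕ → ℝ} (hu : Monotone u) (g : ℝ → ℝ≥0∞) (N : ℕ) :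
    ∫⁻ x in Ioc (u 0) (u N), g x = ∑ n ∈ Finset.range N, ∫⁻ x in Ioc (u n) (u (n + 1)), g x := by
  induction N with
  | zero => simp
  | succ N ih =>
    rw [Finset.sum_range_succ, ← ih, ← lintegral_union measurableSet_Ioc
      (Ioc_disjoint_Ioc_of_le le_rfl), Ioc_union_Ioc_eq_Ioc (hu N.zero_le) (hu N.le_succ)]

theorem lintegral_Ioi_eq_tsum {u : ℕ → ℝ} (hu : Monotone u) (hunbdd : ¬BddAbove (range u))
    (g : ℝ → ℝ≥0∞) :
    ∫⁻ x in Ioi (u 0), g x = ∑' n : ℕ, ∫⁻ x in Ioc (u n) (u (n + 1)), g x := by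
  have hunion : ⋃ n, Ioc (u n) (u (n + 1)) = Ioi (u 0) :=
    iUnion_Ioc_map_succ_eq_Ioi (fun n => hu n.zero_le) hunbdd
  have hdisj : Pairwise (Function.onFun Disjoint fun n => Ioc (u n) (u (n + 1))) :=
    hu.pairwise_disjoint_on_Ioc_succ
  rw [← hunion, lintegral_iUnion (fun _ => measurableSet_Ioc) hdisj]

theorem not_bddAbove_range_natCast_add (m : ℕ) :
    ¬BddAbove (range fun n : ℕ => ((n + m : ℕ) : ℝ)) :=
  Filter.not_bddAbove_of_tendsto_atTop
    (tendsto_natCast_atTop_atTop.comp (Filter.tendsto_add_atTop_nat m))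

theorem lintegral_rpow_le_of_measure_eq_one {p : ℝ} {α : Type*} [MeasurableSpace α] {μ : Measure α}
    (hμ : μ univ = 1) (hp : 1 < p) {f : α → ℝ≥0∞} (hf : AEMeasurable f μ) :
    (∫⁻ x, f x ∂μ) ^ p ≤ ∫⁻ x, f x ^ p ∂μ := by
  have h := ENNReal.lintegral_mul_le_Lp_mul_Lq μ (Real.HolderConjugate.conjExponent hp) hf
    (aemeasurable_const (b := (1 : ℝ≥0∞)))
  simp only [Pi.mul_apply, mul_one, ENNReal.one_rpow, lintegral_one, hμ] at h
  have hpow := ENNReal.rpow_le_rpow h (show 0 ≤ p by linarith)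
  rwa [← ENNReal.rpow_mul, one_div_mul_cancel (by linarith), ENNReal.rpow_one] at hpow

section Hardy

variable {p : ℝ}

theorem hardy_telescoping_step {x y a n : ℝ} (hp : 1 < p) (hx : 0 ≤ x) (hy : 0 ≤ y)
    (ha : 0 ≤ a) (hn : 0 ≤ n) (h : (n + 1) * y = n * x + a) :
    y ^ p + p / (p - 1) * ((n + 1) * y ^ p) ≤
      (p / (p - 1)) ^ p * a ^ p + p / (p - 1) * (n * x ^ p) := by
  have hp' : 0 < p - 1 := by linarith
  set κ := p / (p - 1)
  have hκ0 : 0 ≤ κ := by positivity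
  have hκp : κ * (p - 1) = p := div_mul_cancel₀ _ hp'.ne'
  have hpow : y ^ (p - 1) * y = y ^ p := by
    rw [← Real.rpow_add_one' hy (by linarith), sub_add_cancel]
  have hx_tangent := mul_le_mul_of_nonneg_left (tangent_le_rpow hp hx hy) (mul_nonneg hκ0 hn)
  have ha_tangent := tangent_le_rpow hp (mul_nonneg hκ0 ha) hy
  rw [Real.mul_rpow hκ0 ha] at ha_tangent
  linear_combination hx_tangent + ha_tangent + p * κ * y ^ (p - 1) * h -
    p * κ * (n + 1) * hpow - y ^ p * hκp

theorem hardy_sum_range (hp : 1 < p) {a : ℕ → ℝ} (ha : ∀ n, 0 ≤ a n) (N : ℕ) :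
    ∑ n ∈ Finset.range N, ((n + 1 : ℝ)⁻¹ * ∑ k ∈ Finset.range (n + 1), a k) ^ p ≤
      (p / (p - 1)) ^ p * ∑ n ∈ Finset.range N, a n ^ p := by
  have hmean (n : ℕ) : 0 ≤ (n : ℝ)⁻¹ * ∑ k ∈ Finset.range n, a k :=
    mul_nonneg (by positivity) (Finset.sum_nonneg fun k _ => ha k)
  suffices h : ∑ n ∈ Finset.range N, ((n + 1 : ℝ)⁻¹ * ∑ k ∈ Finset.range (n + 1), a k) ^ p
      + p / (p - 1) * (N * ((N : ℝ)⁻¹ * ∑ k ∈ Finset.range N, a k) ^ p) ≤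
      (p / (p - 1)) ^ p * ∑ n ∈ Finset.range N, a n ^ p by
    refine le_trans (le_add_of_nonneg_right ?_) h
    have := Real.rpow_nonneg (hmean N) p
    positivity
  induction N with
  | zero => simp
  | succ N ih =>
    have hrec : (N + 1 : ℝ) * ((N + 1 : ℝ)⁻¹ * ∑ k ∈ Finset.range (N + 1), a k) =
        N * ((N : ℝ)⁻¹ * ∑ k ∈ Finset.range N, a k) + a N := by
      rw [mul_inv_cancel_left₀ (by positivity), Finset.sum_range_succ]
      rcases N.eq_zero_or_pos with rfl | hN
      · simp
      · rw [mul_inv_cancel_left₀ (by positivity)]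
    have := hardy_telescoping_step hp (hmean N) (by exact_mod_cast hmean (N + 1)) (ha N)
      N.cast_nonneg hrec
    rw [Finset.sum_range_succ, Finset.sum_range_succ (fun n => a n ^ p), mul_add]
    push_cast
    linarith

theorem hardy_tsum (hp : 1 < p) (a : ℕ → ℝ≥0∞) :
    ∑' n : ℕ, (((n + 1 : ℕ) : ℝ≥0∞)⁻¹ * ∑ k ∈ Finset.range (n + 1), a k) ^ p ≤
      ENNReal.ofReal ((p / (p - 1)) ^ p) * ∑' n, a n ^ p := by
  by_cases ha : ∃ n, a n = ⊤
  · obtain ⟨n, hn⟩ := ha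
    have htop : ∑' n, a n ^ p = ⊤ :=
      ENNReal.tsum_eq_top_of_eq_top ⟨n, by rw [hn, ENNReal.top_rpow_of_pos (by linarith)]⟩
    rw [htop, ENNReal.mul_top (ENNReal.ofReal_pos.2 (by positivity)).ne']
    exact le_top
  push Not at ha
  lift a to ℕ → ℝ≥0 using ha
  have hpow (x : ℝ≥0) : ENNReal.ofReal ((x : ℝ) ^ p) = (x : ℝ≥0∞) ^ p := by
    rw [← ENNReal.ofReal_rpow_of_nonneg x.coe_nonneg (by linarith), ENNReal.ofReal_coe_nnreal]
  have hmean (n : ℕ) :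
      ENNReal.ofReal (((n + 1 : ℝ)⁻¹ * ∑ k ∈ Finset.range (n + 1), (a k : ℝ)) ^ p) =
        (((n + 1 : ℕ) : ℝ≥0∞)⁻¹ * ∑ k ∈ Finset.range (n + 1), (a k : ℝ≥0∞)) ^ p := by
    rw [← ENNReal.ofReal_rpow_of_nonneg (by positivity) (by linarith),
      ENNReal.ofReal_mul (by positivity), ENNReal.ofReal_inv_of_pos (by positivity),
      ← Nat.cast_add_one, ENNReal.ofReal_natCast,
      ENNReal.ofReal_sum_of_nonneg (by intros; positivity)]
    simp only [ENNReal.ofReal_coe_nnreal]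
  refine ENNReal.tsum_le_of_sum_range_le fun N => ?_
  have h := ENNReal.ofReal_le_ofReal (hardy_sum_range hp (fun n => (a n).coe_nonneg) N)
  rw [ENNReal.ofReal_mul (by positivity), ENNReal.ofReal_sum_of_nonneg (by intros; positivity),
    ENNReal.ofReal_sum_of_nonneg (by intros; positivity)] at h
  simp only [hpow, hmean] at h
  exact h.trans (by gcongr; exact ENNReal.sum_le_tsum _)

theorem hardy_sum_integral (hp : 1 < p) {f : ℝ → ℝ≥0∞}
    (hf : AEMeasurable f (volume.restrict (Ioi 1))) :
    ∑' n : ℕ, (((n + 1 : ℕ) : ℝ≥0∞)⁻¹ * ∫⁻ t in Ioc (1 : ℝ) ((n + 1 : ℕ) : ℝ), f t) ^ p ≤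
      ENNReal.ofReal ((p / (p - 1)) ^ p) * ∫⁻ x in Ioi (1 : ℝ), f x ^ p := by
  set u : ℕ → ℝ := fun n => ((n + 1 : ℕ) : ℝ)
  have hu : Monotone u := Nat.mono_cast.comp fun _ _ h => Nat.succ_le_succ h
  have hu0 : u 0 = 1 := by simp [u]
  have hjensen (n : ℕ) : (∫⁻ t in Ioc (u n) (u (n + 1)), f t) ^ p ≤
      ∫⁻ t in Ioc (u n) (u (n + 1)), f t ^ p := by
    refine lintegral_rpow_le_of_measure_eq_one (by simp [u]) hp
      (hf.mono_measure (Measure.restrict_mono ?_ le_rfl))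
    exact Ioc_subset_Ioi_self.trans (Ioi_subset_Ioi (hu0 ▸ hu n.zero_le))
  calc
    _ ≤ ∑' n : ℕ, (((n + 1 : ℕ) : ℝ≥0∞)⁻¹ *
          ∑ k ∈ Finset.range (n + 1), ∫⁻ t in Ioc (u k) (u (k + 1)), f t) ^ p := by
      refine ENNReal.tsum_le_tsum fun n => ENNReal.rpow_le_rpow ?_ (by linarith)
      rw [← lintegral_Ioc_eq_sum hu, hu0]
      gcongr
      exact hu n.le_succ
    _ ≤ ENNReal.ofReal ((p / (p - 1)) ^ p) * ∑' n, (∫⁻ t in Ioc (u n) (u (n + 1)), f t) ^ p :=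
      hardy_tsum hp _
    _ ≤ ENNReal.ofReal ((p / (p - 1)) ^ p) * ∑' n, ∫⁻ t in Ioc (u n) (u (n + 1)), f t ^ p := by
      gcongr with n
      exact hjensen n
    _ = _ := by
      rw [← lintegral_Ioi_eq_tsum hu (not_bddAbove_range_natCast_add 1), hu0]

end Hardy

/-! ### The two branches of a level equation -/

section LevelBranches

variable {h : ℝ → ℝ} {a b c : ℝ}

theorem strictMonoOn_Icc_of_strictConcaveOn_of_isMaxOn (hconc : StrictConcaveOn ℝ (Icc a b) h)
    (hc : c ∈ Icc a b) (hmax : IsMaxOn h (Icc a b) c) : StrictMonoOn h (Icc a c) := by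
  intro x hx y hy hxy
  have hxab : x ∈ Icc a b := ⟨hx.1, hx.2.trans hc.2⟩
  have hxc : h x ≤ h c := hmax hxab
  rcases hy.2.eq_or_lt with rfl | hyc
  · refine hxc.lt_of_ne fun heq => hxy.ne (hconc.eq_of_isMaxOn ?_ hmax hxab hc)
    exact fun z hz => (hmax hz).trans_eq heq.symm
  · simpa only [min_eq_left hxc] using hconc.lt_on_openSegment hxab hc (hxy.trans hyc).ne
      (Ioo_subset_openSegment ⟨hxy, hyc⟩)

theorem strictAntiOn_Icc_of_strictConcaveOn_of_isMaxOn (hconc : StrictConcaveOn ℝ (Icc a b) h)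
    (hc : c ∈ Icc a b) (hmax : IsMaxOn h (Icc a b) c) : StrictAntiOn h (Icc c b) := by
  intro x hx y hy hxy
  have hyab : y ∈ Icc a b := ⟨hc.1.trans hy.1, hy.2⟩
  have hyc : h y ≤ h c := hmax hyab
  rcases hx.1.eq_or_lt with rfl | hcx
  · refine hyc.lt_of_ne fun heq => hxy.ne (hconc.eq_of_isMaxOn hmax ?_ hc hyab)
    exact fun z hz => (hmax hz).trans_eq heq.symm
  · simpa only [min_eq_right hyc] using hconc.lt_on_openSegment hc hyab (hcx.trans hxy).ne
      (Ioo_subset_openSegment ⟨hcx, hxy⟩)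

theorem exists_continuous_leftInvOn_Icc {m : ℝ → ℝ} {a b : ℝ} (hab : a ≤ b)
    (hm : ContinuousOn m (Icc a b)) (hinj : InjOn m (Icc a b)) :
    ∃ g : ℝ → ℝ, Continuous g ∧ (∀ t, g t ∈ Icc a b) ∧ LeftInvOn g m (Icc a b) := by
  obtain ⟨g, hgIcc, hgm⟩ := ContinuousMap.exists_extension_forall_mem_of_isClosedEmbedding
    (⟨Subtype.val, continuous_subtype_val⟩ : C(Icc a b, ℝ)) (fun x => x.2)
    (nonempty_Icc.2 hab) (hm.domRestrict.isClosedEmbedding hinj.injective)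
  exact ⟨g, g.continuous, hgIcc, fun x hx => congr_fun hgm ⟨x, hx⟩⟩

/-- Continuous functions `lower` and `upper` selecting, for each level `t ∈ [0, M]` of a function
`h` on `[0, 1]`, the two ends of the superlevel set `{h ≥ t}`; `M` is the maximum of `h`. -/
structure LevelBranches (h : ℝ → ℝ) (M : ℝ) where
  lower : ℝ → ℝ
  upper : ℝ → ℝ
  continuous_lower : Continuous lower
  continuous_upper : Continuous upper
  lower_mem (t : ℝ) : lower t ∈ Icc (0 : ℝ) 1
  upper_mem (t : ℝ) : upper t ∈ Icc (0 : ℝ) 1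
  apply_lower {t : ℝ} : t ∈ Icc 0 M → h (lower t) = t
  apply_upper {t : ℝ} : t ∈ Icc 0 M → h (upper t) = t
  le_max {c : ℝ} : c ∈ Icc (0 : ℝ) 1 → h c ≤ M
  mem_Icc_of_le {c t : ℝ} : c ∈ Icc (0 : ℝ) 1 → 0 ≤ t → t ≤ h c → c ∈ Icc (lower t) (upper t)

theorem exists_levelBranches (hcont : ContinuousOn h (Icc 0 1)) (hc : c ∈ Icc (0 : ℝ) 1)
    (hmono : StrictMonoOn h (Icc 0 c)) (hanti : StrictAntiOn h (Icc c 1))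
    (h0 : h 0 = 0) (h1 : h 1 = 0) : Nonempty (LevelBranches h (h c)) := by
  have hleft : ContinuousOn h (Icc 0 c) := hcont.mono (Icc_subset_Icc_right hc.2)
  have hright : ContinuousOn h (Icc c 1) := hcont.mono (Icc_subset_Icc_left hc.1)
  have hmax {x : ℝ} (hx : x ∈ Icc (0 : ℝ) 1) : h x ≤ h c := by
    rcases le_total x c with hxc | hcx
    · exact hmono.monotoneOn ⟨hx.1, hxc⟩ ⟨hc.1, le_rfl⟩ hxc
    · exact hanti.antitoneOn ⟨le_rfl, hc.2⟩ ⟨hcx, hx.2⟩ hcx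
  obtain ⟨g₁, hg₁, hg₁mem, hg₁inv⟩ := exists_continuous_leftInvOn_Icc hc.1 hleft hmono.injOn
  obtain ⟨g₂, hg₂, hg₂mem, hg₂inv⟩ := exists_continuous_leftInvOn_Icc hc.2 hright hanti.injOn
  have happly₁ {t : ℝ} (ht : t ∈ Icc 0 (h c)) : h (g₁ t) = t := by
    obtain ⟨x, hx, rfl⟩ := intermediate_value_Icc hc.1 hleft (h0.symm ▸ ht)
    rw [hg₁inv hx]
  have happly₂ {t : ℝ} (ht : t ∈ Icc 0 (h c)) : h (g₂ t) = t := by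
    obtain ⟨x, hx, rfl⟩ := intermediate_value_Icc' hc.2 hright (h1.symm ▸ ht)
    rw [hg₂inv hx]
  refine ⟨⟨g₁, g₂, hg₁, hg₂, fun t => Icc_subset_Icc_right hc.2 (hg₁mem t),
    fun t => Icc_subset_Icc_left hc.1 (hg₂mem t), happly₁, happly₂, hmax,
    fun {x t} hx ht0 htx => ?_⟩⟩
  have ht : t ∈ Icc 0 (h c) := ⟨ht0, htx.trans (hmax hx)⟩
  rcases le_total x c with hxc | hcx
  · exact ⟨(hmono.le_iff_le (hg₁mem t) ⟨hx.1, hxc⟩).1 ((happly₁ ht).trans_le htx),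
      hxc.trans (hg₂mem t).1⟩
  · exact ⟨(hg₁mem t).2.trans hcx,
      (hanti.le_iff_ge (hg₂mem t) ⟨hcx, hx.2⟩).1 ((happly₂ ht).trans_le htx)⟩

namespace LevelBranches

variable {M : ℝ} (B : LevelBranches h M)

theorem lower_le_upper {t : ℝ} (ht : t ∈ Icc 0 M) : B.lower t ≤ B.upper t :=
  (B.mem_Icc_of_le (B.lower_mem t) ht.1 (B.apply_lower ht).ge).2

theorem integral_le_integral_upper_sub_lower (hcont : ContinuousOn h (Icc 0 1))
    (hnonneg : ∀ c ∈ Icc (0 : ℝ) 1, 0 ≤ h c) (hM : 0 ≤ M) :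
    ∫ c in (0 : ℝ)..1, h c ≤ ∫ t in (0 : ℝ)..M, (B.upper t - B.lower t) := by
  have hlevel {t : ℝ} (ht : t ∈ Ioc 0 M) :
      (volume.restrict (Icc (0 : ℝ) 1)).real {c | t ≤ h c} ≤ B.upper t - B.lower t := by
    rw [measureReal_restrict_apply' measurableSet_Icc,
      ← Real.volume_real_Icc_of_le (B.lower_le_upper (Ioc_subset_Icc_self ht))]
    exact measureReal_mono (fun c hc => B.mem_Icc_of_le hc.2 ht.1.le hc.1) measure_Icc_lt_top.ne
  have hempty {t : ℝ} (ht : t ∈ Ioi 0 \ Ioc 0 M) :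
      (volume.restrict (Icc (0 : ℝ) 1)).real {c | t ≤ h c} = 0 := by
    have : {c | t ≤ h c} ∩ Icc 0 1 = ∅ := by
      refine eq_empty_of_forall_notMem fun c hc => ht.2 ⟨ht.1, ?_⟩
      exact (show t ≤ h c from hc.1).trans (B.le_max hc.2)
    rw [measureReal_restrict_apply' measurableSet_Icc, this, measureReal_empty]
  rw [intervalIntegral.integral_of_le zero_le_one, ← integral_Icc_eq_integral_Ioc,
    hcont.integrableOn_Icc.integral_eq_integral_meas_le
      ((ae_restrict_iff' measurableSet_Icc).2 (.of_forall hnonneg)),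
    setIntegral_eq_of_subset_of_forall_sdiff_eq_zero measurableSet_Ioi Ioc_subset_Ioi_self
      (fun t ht => hempty ht), intervalIntegral.integral_of_le hM]
  refine integral_mono_of_nonneg (.of_forall fun _ => measureReal_nonneg)
    ((B.continuous_upper.sub B.continuous_lower).intervalIntegrable 0 M).1 ?_
  exact (ae_restrict_iff' measurableSet_Ioc).2 (.of_forall fun t ht => hlevel ht)

end LevelBranches

end LevelBranches

/-! ### Bliss's inequality -/

/-- The quantity `F(x) ^ p * x ^ (1 - p)`, where `F` is the primitive of `f` vanishing at `0`, used
for `x > 0`. Along it Bliss's inequality is calibrated: the integrand of the latter is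
`blissRatio p f x ^ (1 + r) / x`. -/
noncomputable def blissRatio (p : ℝ) (f : ℝ → ℝ) (x : ℝ) : ℝ :=
  (∫ t in (0 : ℝ)..x, f t) ^ p * x ^ (1 - p)

section Calibration

variable {p a b : ℝ} {f : ℝ → ℝ}

theorem absolutelyContinuousOnInterval_blissRatio (hp : 1 ≤ p) (ha : 0 < a) (hab : a ≤ b)
    (hf : IntervalIntegrable f volume 0 b) :
    AbsolutelyContinuousOnInterval (blissRatio p f) a b := by
  have hsub : uIcc a b ⊆ uIcc 0 b := by
    rw [uIcc_of_le hab, uIcc_of_le (ha.le.trans hab)]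
    exact Icc_subset_Icc_left ha.le
  have hF := (hf.absolutelyContinuousOnInterval_intervalIntegral left_mem_uIcc).mono hsub
  have hpow : ContDiff ℝ 1 fun y : ℝ => y ^ p :=
    Real.contDiff_rpow_const_of_le (n := 1) (by simpa using hp)
  refine (absolutelyContinuousOnInterval_comp_of_contDiff hpow hF).fun_mul ?_
  refine ContDiffOn.absolutelyContinuousOnInterval fun x hx => ?_
  rw [uIcc_of_le hab] at hx
  exact (Real.contDiffAt_rpow_const_of_ne (ha.trans_le hx.1).ne').contDiffWithinAt

theorem blissRatio_div_self {x : ℝ} (hx : 0 < x) (hF : 0 ≤ ∫ t in (0 : ℝ)..x, f t) :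
    blissRatio p f x / x = ((∫ t in (0 : ℝ)..x, f t) / x) ^ p := by
  rw [blissRatio, Real.div_rpow hF hx.le, Real.rpow_sub hx, Real.rpow_one]
  field_simp

theorem hasDerivAt_blissRatio {x : ℝ} (hp : 1 < p) (hx : 0 < x)
    (hF : 0 ≤ ∫ t in (0 : ℝ)..x, f t)
    (hderiv : HasDerivAt (fun y => ∫ t in (0 : ℝ)..y, f t) (f x) x) :
    HasDerivAt (blissRatio p f)
      (p * ((∫ t in (0 : ℝ)..x, f t) / x) ^ (p - 1) * f x -
        (p - 1) * (blissRatio p f x / x)) x := by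
  refine ((hderiv.rpow_const (p := p) (.inr hp.le)).mul
    (Real.hasDerivAt_rpow_const (p := 1 - p) (.inl hx.ne'))).congr_deriv ?_
  rw [Real.div_rpow hF hx.le, blissRatio, show 1 - p - 1 = (1 - p) + (-1) by ring,
    Real.rpow_add hx, Real.rpow_neg_one, show 1 - p = -(p - 1) by ring, Real.rpow_neg hx.le]
  field_simp
  ring

theorem weighted_tangent_le_rpow {x y c : ℝ} (hp : 1 < p) (hx : 0 ≤ x) (hy : 0 ≤ y) (hc : 0 ≤ c) :
    c * (p * y ^ (p - 1) * x - (p - 1) * y ^ p) + (p - 1) * ((c - c ^ (p / (p - 1))) * y ^ p)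
      ≤ x ^ p := by
  have htangent := tangent_le_rpow hp hx (mul_nonneg (Real.rpow_nonneg hc (1 / (p - 1))) hy)
  have hp' : p - 1 ≠ 0 := by linarith
  rw [Real.mul_rpow (by positivity) hy, Real.mul_rpow (by positivity) hy, ← Real.rpow_mul hc,
    ← Real.rpow_mul hc, one_div_mul_cancel hp', Real.rpow_one, one_div_mul_eq_div] at htangent
  linarith

theorem calibration_le_integral_rpow {ζ : ℝ → ℝ} (hp : 1 < p) (ha : 0 < a) (hab : a ≤ b)
    (hf0 : ∀ x, 0 ≤ f x) (hf : IntervalIntegrable f volume 0 b)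
    (hfp : IntervalIntegrable (fun x => f x ^ p) volume a b)
    (hζ : Continuous ζ) (hζ0 : ∀ t, 0 ≤ ζ t) :
    (∫ t in blissRatio p f a..blissRatio p f b, ζ t) +
        (p - 1) * ∫ x in a..b, (ζ (blissRatio p f x) - ζ (blissRatio p f x) ^ (p / (p - 1))) *
          (blissRatio p f x / x) ≤
      ∫ x in a..b, f x ^ p := by
  set Φ : ℝ → ℝ := fun y => ∫ t in (0 : ℝ)..y, ζ t
  have hu := absolutelyContinuousOnInterval_blissRatio hp.le ha hab hf
  have hΦu := absolutelyContinuousOnInterval_comp_of_contDiff (contDiff_one_integral hζ) hu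
  have hleft : ∫ t in blissRatio p f a..blissRatio p f b, ζ t =
      ∫ x in a..b, deriv (fun x => Φ (blissRatio p f x)) x := by
    rw [hΦu.integral_deriv_eq_sub, intervalIntegral.integral_interval_sub_left] <;>
      exact hζ.intervalIntegrable _ _
  have hint : IntervalIntegrable (fun x => (ζ (blissRatio p f x) -
      ζ (blissRatio p f x) ^ (p / (p - 1))) * (blissRatio p f x / x)) volume a b := by
    have hζu := hζ.comp_continuousOn hu.continuousOn
    refine ContinuousOn.intervalIntegrable ((hζu.sub (hζu.rpow_const fun _ _ => .inr ?_)).mul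
      (hu.continuousOn.div continuousOn_id fun x hx => ?_))
    · exact div_nonneg (by linarith) (by linarith)
    · rw [uIcc_of_le hab] at hx
      exact (ha.trans_le hx.1).ne'
  rw [hleft, ← intervalIntegral.integral_const_mul,
    ← intervalIntegral.integral_add hΦu.intervalIntegrable_deriv (hint.const_mul _)]
  refine intervalIntegral.integral_mono_ae_restrict hab
    (hΦu.intervalIntegrable_deriv.add (hint.const_mul _)) hfp ?_
  rw [Filter.EventuallyLE, ae_restrict_iff' measurableSet_Icc]
  filter_upwards [hf.ae_hasDerivAt_integral] with x hderiv hx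
  have hx0 : 0 < x := ha.trans_le hx.1
  have hF : 0 ≤ ∫ t in (0 : ℝ)..x, f t := intervalIntegral.integral_nonneg hx0.le fun t _ => hf0 t
  have hx0b : x ∈ uIcc 0 b := by rw [uIcc_of_le (hx0.le.trans hx.2)]; exact ⟨hx0.le, hx.2⟩
  have hderivΦu := (hζ.integral_hasStrictDerivAt 0 _).hasDerivAt.comp x
    (hasDerivAt_blissRatio hp hx0 hF (hderiv hx0b 0 left_mem_uIcc))
  rw [show deriv (fun x => Φ (blissRatio p f x)) x = _ from hderivΦu.deriv,
    blissRatio_div_self hx0 hF]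
  exact weighted_tangent_le_rpow hp (hf0 x) (div_nonneg hF hx0.le) (hζ0 _)

end Calibration

/-- The level function of the calibration on `c ∈ [0, 1]`: a calibrating function takes the value
`c` where `blissRatio` equals a fixed scale `s` times `blissProfile p r c`. -/
noncomputable def blissProfile (p r c : ℝ) : ℝ :=
  (c - c ^ (p / (p - 1))) ^ (1 / r)

section BlissProfile

variable {p r : ℝ}

theorem continuous_blissProfile (hp : 1 < p) (hr : 0 < r) : Continuous (blissProfile p r) :=
  (continuous_id.sub (Real.continuous_rpow_const
    (zero_lt_one.trans (one_lt_div_sub_one hp)).le)).rpow_const fun _ => .inr (by positivity)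

theorem exists_levelBranches_blissProfile (hp : 1 < p) (hr : 0 < r) :
    ∃ M, 0 < M ∧ Nonempty (LevelBranches (blissProfile p r) M) := by
  have hconc := strictConcaveOn_sub_rpow (one_lt_div_sub_one hp)
  have hcont : Continuous fun c : ℝ => c - c ^ (p / (p - 1)) :=
    continuous_id.sub (Real.continuous_rpow_const (zero_lt_one.trans (one_lt_div_sub_one hp)).le)
  obtain ⟨c, hc, hmax⟩ := isCompact_Icc.exists_isMaxOn (nonempty_Icc.2 zero_le_one)
    hcont.continuousOn
  have hr' : 0 < 1 / r := by positivity
  have hnonneg {x : ℝ} (hx : x ∈ Icc (0 : ℝ) 1) := sub_rpow_nonneg (one_lt_div_sub_one hp).le hx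
  refine ⟨blissProfile p r c, Real.rpow_pos_of_pos ?_ _, exists_levelBranches
    (continuous_blissProfile hp hr).continuousOn hc ?_ ?_ ?_ ?_⟩
  · have hhalf : (1 / 2 : ℝ) - (1 / 2) ^ (p / (p - 1)) ≤ c - c ^ (p / (p - 1)) :=
      hmax (show (1 / 2 : ℝ) ∈ Icc 0 1 by norm_num)
    have := Real.rpow_lt_self_of_lt_one (x := 1 / 2) one_half_pos one_half_lt_one
      (one_lt_div_sub_one hp)
    linarith
  · intro x hx y hy hxy
    exact Real.rpow_lt_rpow (hnonneg ⟨hx.1, hx.2.trans hc.2⟩)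
      (strictMonoOn_Icc_of_strictConcaveOn_of_isMaxOn hconc hc hmax hx hy hxy) hr'
  · intro x hx y hy hxy
    exact Real.rpow_lt_rpow (hnonneg ⟨hc.1.trans hy.1, hy.2⟩)
      (strictAntiOn_Icc_of_strictConcaveOn_of_isMaxOn hconc hc hmax hx hy hxy) hr'
  · rw [blissProfile, Real.zero_rpow (zero_lt_one.trans (one_lt_div_sub_one hp)).ne', sub_zero,
      Real.zero_rpow hr'.ne']
  · rw [blissProfile, Real.one_rpow, sub_self, Real.zero_rpow hr'.ne']

theorem integral_blissProfile (hp : 1 < p) (hr : 0 < r) :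
    (1 + r) * ∫ c in (0 : ℝ)..1, blissProfile p r c =
      eulerBeta (1 / r) ((p * (1 + r) - 1) / r) := by
  have hp' : 0 < p - 1 := sub_pos.2 hp
  have hb : 0 < (p - 1) * (1 + r) / r := by positivity
  have hJ : ∫ c in (0 : ℝ)..1, blissProfile p r c =
      (p - 1) * eulerBeta ((p - 1) * (1 + r) / r) (1 / r + 1) := by
    rw [integral_zero_one_comp_rpow hp', eulerBeta, ← intervalIntegral.integral_const_mul,
      intervalIntegral.integral_of_le zero_le_one, intervalIntegral.integral_of_le zero_le_one]
    refine setIntegral_congr_fun measurableSet_Ioc fun x hx => ?_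
    have hx0 : 0 < x := hx.1
    have hx1 : 0 ≤ 1 - x := sub_nonneg.2 hx.2
    have hprofile : x ^ (p - 1) - (x ^ (p - 1)) ^ (p / (p - 1)) = x ^ (p - 1) * (1 - x) := by
      rw [← Real.rpow_mul hx0.le, mul_div_cancel₀ _ hp'.ne', mul_one_sub,
        ← Real.rpow_add_one hx0.ne', sub_add_cancel]
    have hexp : (p - 1) * (1 + r) / r - 1 = p - 1 - 1 + (p - 1) * (1 / r) := by
      field_simp; ring
    simp only [blissProfile]
    rw [hprofile, Real.mul_rpow (by positivity) hx1, ← Real.rpow_mul hx0.le, hexp,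
      Real.rpow_add hx0, add_sub_cancel_right]
    ring
  have hb1 : (p * (1 + r) - 1) / r = (p - 1) * (1 + r) / r + 1 := by field_simp; ring
  have hrec := mul_eulerBeta_add_one_symm (one_div_pos.2 hr) hb
  rw [hJ, hb1]
  generalize eulerBeta ((p - 1) * (1 + r) / r) (1 / r + 1) = B₁ at hrec ⊢
  generalize eulerBeta (1 / r) ((p - 1) * (1 + r) / r + 1) = B₂ at hrec ⊢
  field_simp at hrec
  linarith

end BlissProfile

section BlissPeak

variable {p r a b : ℝ} {f : ℝ → ℝ}

theorem blissRatio_nonneg {x : ℝ} (hx : 0 ≤ x) (hf0 : ∀ x, 0 ≤ f x) : 0 ≤ blissRatio p f x :=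
  mul_nonneg (Real.rpow_nonneg (intervalIntegral.integral_nonneg hx fun t _ => hf0 t) _)
    (Real.rpow_nonneg hx _)

theorem blissRatio_le_integral_rpow (hp : 1 < p) (ha : 0 < a) (hf0 : ∀ x, 0 ≤ f x)
    (hf : IntervalIntegrable f volume 0 a)
    (hfp : IntervalIntegrable (fun x => f x ^ p) volume 0 a) :
    blissRatio p f a ≤ ∫ x in (0 : ℝ)..a, f x ^ p := by
  set F := ∫ t in (0 : ℝ)..a, f t with hF
  have hF0 : 0 ≤ F := intervalIntegral.integral_nonneg ha.le fun t _ => hf0 t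
  have hmean : 0 ≤ F / a := by positivity
  calc blissRatio p f a
      = p * (F / a) ^ (p - 1) * F - (p - 1) * (F / a) ^ p * a := by
        rw [← div_mul_cancel₀ (blissRatio p f a) ha.ne', blissRatio_div_self ha hF0, ← hF]
        have hpow : (F / a) ^ (p - 1) * F = (F / a) ^ p * a := by
          rw [← sub_add_cancel p 1, Real.rpow_add_one' hmean (by linarith), add_sub_cancel_right,
            mul_assoc, div_mul_cancel₀ F ha.ne']
        linear_combination -p * hpow
    _ = ∫ x in (0 : ℝ)..a, (p * (F / a) ^ (p - 1) * f x - (p - 1) * (F / a) ^ p) := by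
        rw [intervalIntegral.integral_sub (hf.const_mul _) intervalIntegrable_const,
          intervalIntegral.integral_const_mul, intervalIntegral.integral_const, sub_zero,
          smul_eq_mul, mul_comm a]
    _ ≤ ∫ x in (0 : ℝ)..a, f x ^ p :=
        intervalIntegral.integral_mono_on ha.le ((hf.const_mul _).sub intervalIntegrable_const) hfp
          fun x _ => tangent_le_rpow hp (hf0 x) hmean

theorem intervalIntegrable_blissRatio_rpow_div (hp : 1 ≤ p) (hr : 0 ≤ 1 + r) (ha : 0 < a)
    (hab : a ≤ b) (hf : IntervalIntegrable f volume 0 b) :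
    IntervalIntegrable (fun x => blissRatio p f x ^ (1 + r) / x) volume a b := by
  refine (ContinuousOn.div ((absolutelyContinuousOnInterval_blissRatio hp ha hab
    hf).continuousOn.rpow_const fun x _ => .inr hr) continuousOn_id
    fun x hx => ?_).intervalIntegrable
  rw [uIcc_of_le hab] at hx
  exact (ha.trans_le hx.1).ne'

theorem integral_blissRatio_rpow_div_nonneg (ha : 0 ≤ a) (hab : a ≤ b) (hf0 : ∀ x, 0 ≤ f x) :
    0 ≤ ∫ x in a..b, blissRatio p f x ^ (1 + r) / x :=
  intervalIntegral.integral_nonneg hab fun _ hx =>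
    div_nonneg (Real.rpow_nonneg (blissRatio_nonneg (ha.trans hx.1) hf0) _) (ha.trans hx.1)

theorem calibration_blissProfile_le_integral_rpow {g : ℝ → ℝ} {V s : ℝ} (hp : 1 < p)
    (hr : 0 < r) (ha : 0 < a) (hab : a ≤ b) (hf0 : ∀ x, 0 ≤ f x)
    (hf : IntervalIntegrable f volume 0 b)
    (hfp : IntervalIntegrable (fun x => f x ^ p) volume a b) (hg : Continuous g)
    (hg01 : ∀ t, g t ∈ Icc (0 : ℝ) 1) (hgV : ∀ t ∈ Icc 0 V, blissProfile p r (g t) = t)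
    (hs : 0 < s) (huV : ∀ x ∈ Icc a b, blissRatio p f x ≤ s * V) :
    (∫ y in blissRatio p f a..blissRatio p f b, g (y / s)) +
        (p - 1) / s ^ r * ∫ x in a..b, blissRatio p f x ^ (1 + r) / x ≤
      ∫ x in a..b, f x ^ p := by
  refine (add_le_add_right (le_of_eq ?_) _).trans (calibration_le_integral_rpow hp ha hab hf0 hf
    hfp (hg.comp (continuous_id.div_const s)) fun t => (hg01 _).1)
  rw [div_mul_eq_mul_div, mul_div_assoc, ← intervalIntegral.integral_div]
  congr 1
  refine intervalIntegral.integral_congr fun x hx => ?_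
  rw [uIcc_of_le hab] at hx
  have hx0 : 0 < x := ha.trans_le hx.1
  have hu0 : 0 ≤ blissRatio p f x := blissRatio_nonneg hx0.le hf0
  have hlevel := hgV (blissRatio p f x / s) ⟨by positivity, (div_le_iff₀' hs).2 (huV x hx)⟩
  have hprofile : g (blissRatio p f x / s) - g (blissRatio p f x / s) ^ (p / (p - 1)) =
      (blissRatio p f x / s) ^ r := by
    rw [blissProfile, one_div] at hlevel
    have hpos := sub_rpow_nonneg (one_lt_div_sub_one hp).le (hg01 (blissRatio p f x / s))
    rw [← hlevel, Real.rpow_inv_rpow hpos hr.ne', hlevel]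
  change _ = (g (blissRatio p f x / s) - g (blissRatio p f x / s) ^ (p / (p - 1))) * _
  rw [hprofile, Real.div_rpow hu0 hs.le, add_comm 1 r, Real.rpow_add_one' hu0 (by linarith)]
  ring

theorem integral_comp_div_blissRatio {V s c : ℝ} (hs : 0 < s)
    (huc : blissRatio p f c = s * V) (g : ℝ → ℝ) :
    ∫ y in (0 : ℝ)..blissRatio p f c, g (y / s) = s * ∫ t in (0 : ℝ)..V, g t := by
  rw [huc, intervalIntegral.integral_comp_div _ hs.ne', zero_div, mul_div_cancel_left₀ _ hs.ne',
    smul_eq_mul]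

theorem calibration_before_peak_le_integral_rpow {g : ℝ → ℝ} {V s : ℝ} (hp : 1 < p)
    (hr : 0 < r) (ha : 0 < a) (hab : a ≤ b) (hf0 : ∀ x, 0 ≤ f x)
    (hf : IntervalIntegrable f volume 0 b)
    (hfp : IntervalIntegrable (fun x => f x ^ p) volume 0 b) (hg : Continuous g)
    (hg01 : ∀ t, g t ∈ Icc (0 : ℝ) 1) (hgV : ∀ t ∈ Icc 0 V, blissProfile p r (g t) = t)
    (hs : 0 < s) (hmax : IsMaxOn (blissRatio p f) (Icc a b) b) (hub : blissRatio p f b = s * V) :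
    s * (∫ t in (0 : ℝ)..V, g t) + (p - 1) / s ^ r * ∫ x in a..b, blissRatio p f x ^ (1 + r) / x ≤
      ∫ x in (0 : ℝ)..b, f x ^ p := by
  have hma : a ∈ uIcc 0 b := by rw [uIcc_of_le (ha.le.trans hab)]; exact ⟨ha.le, hab⟩
  have h0a : uIcc 0 a ⊆ uIcc 0 b := uIcc_subset_uIcc_left hma
  have hfa : IntervalIntegrable (fun x => f x ^ p) volume 0 a := hfp.mono_set h0a
  have hfab : IntervalIntegrable (fun x => f x ^ p) volume a b :=
    hfp.mono_set (uIcc_subset_uIcc_right hma)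
  have hgs (x y : ℝ) : IntervalIntegrable (fun y => g (y / s)) volume x y :=
    (hg.comp (continuous_id.div_const s)).intervalIntegrable x y
  have hstart : ∫ y in (0 : ℝ)..blissRatio p f a, g (y / s) ≤ ∫ x in (0 : ℝ)..a, f x ^ p := by
    refine le_trans ?_ (blissRatio_le_integral_rpow hp ha hf0 (hf.mono_set h0a) hfa)
    simpa only [intervalIntegral.integral_const, sub_zero, smul_eq_mul, mul_one] using
      intervalIntegral.integral_mono_on (blissRatio_nonneg ha.le hf0) (hgs _ _)
        intervalIntegrable_const fun y _ => (hg01 (y / s)).2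
  have hmain := calibration_blissProfile_le_integral_rpow hp hr ha hab hf0 hf hfab hg hg01 hgV hs
    fun x hx => (hmax hx).trans_eq hub
  rw [← intervalIntegral.integral_interval_sub_left (hgs 0 _) (hgs 0 _),
    integral_comp_div_blissRatio hs hub] at hmain
  rw [← intervalIntegral.integral_add_adjacent_intervals hfa hfab]
  linarith

theorem calibration_after_peak_le_integral_rpow {g : ℝ → ℝ} {V s : ℝ} (hp : 1 < p)
    (hr : 0 < r) (ha : 0 < a) (hab : a ≤ b) (hf0 : ∀ x, 0 ≤ f x)
    (hf : IntervalIntegrable f volume 0 b)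
    (hfp : IntervalIntegrable (fun x => f x ^ p) volume a b) (hg : Continuous g)
    (hg01 : ∀ t, g t ∈ Icc (0 : ℝ) 1) (hgV : ∀ t ∈ Icc 0 V, blissProfile p r (g t) = t)
    (hs : 0 < s) (hmax : IsMaxOn (blissRatio p f) (Icc a b) a) (hua : blissRatio p f a = s * V) :
    (p - 1) / s ^ r * ∫ x in a..b, blissRatio p f x ^ (1 + r) / x ≤
      (∫ x in a..b, f x ^ p) + s * ∫ t in (0 : ℝ)..V, g t := by
  have hgs (x y : ℝ) : IntervalIntegrable (fun y => g (y / s)) volume x y :=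
    (hg.comp (continuous_id.div_const s)).intervalIntegrable x y
  have hend : 0 ≤ ∫ y in (0 : ℝ)..blissRatio p f b, g (y / s) :=
    intervalIntegral.integral_nonneg (blissRatio_nonneg (ha.le.trans hab) hf0) fun y _ => (hg01 _).1
  have hmain := calibration_blissProfile_le_integral_rpow hp hr ha hab hf0 hf hfp hg hg01 hgV hs
    fun x hx => (hmax hx).trans_eq hua
  rw [← intervalIntegral.integral_interval_sub_left (hgs 0 _) (hgs 0 _),
    integral_comp_div_blissRatio hs hua] at hmain
  linarith

theorem calibration_levelBranches_le_integral_rpow {V s c : ℝ}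
    (B : LevelBranches (blissProfile p r) V) (hp : 1 < p) (hr : 0 < r) (ha : 0 < a)
    (hc : c ∈ Icc a b) (hf0 : ∀ x, 0 ≤ f x) (hf : IntervalIntegrable f volume 0 b)
    (hfp : IntervalIntegrable (fun x => f x ^ p) volume 0 b) (hs : 0 < s)
    (hmax : IsMaxOn (blissRatio p f) (Icc a b) c) (huc : blissRatio p f c = s * V) :
    s * (∫ t in (0 : ℝ)..V, (B.upper t - B.lower t)) +
        (p - 1) / s ^ r * ∫ x in a..b, blissRatio p f x ^ (1 + r) / x ≤
      ∫ x in (0 : ℝ)..b, f x ^ p := by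
  have hc0 : 0 < c := ha.trans_le hc.1
  have hmc : c ∈ uIcc 0 b := by rw [uIcc_of_le (hc0.le.trans hc.2)]; exact ⟨hc0.le, hc.2⟩
  have hmc' : c ∈ uIcc a b := by rw [uIcc_of_le (hc.1.trans hc.2)]; exact hc
  have hfc : IntervalIntegrable (fun x => f x ^ p) volume 0 c :=
    hfp.mono_set (uIcc_subset_uIcc_left hmc)
  have hfcb : IntervalIntegrable (fun x => f x ^ p) volume c b :=
    hfp.mono_set (uIcc_subset_uIcc_right hmc)
  have hup := calibration_before_peak_le_integral_rpow hp hr ha hc.1 hf0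
    (hf.mono_set (uIcc_subset_uIcc_left hmc)) hfc B.continuous_upper B.upper_mem
    (fun t => B.apply_upper) hs (hmax.on_subset (Icc_subset_Icc_right hc.2)) huc
  have hlow := calibration_after_peak_le_integral_rpow hp hr hc0 hc.2 hf0 hf hfcb
    B.continuous_lower B.lower_mem (fun t => B.apply_lower) hs
    (hmax.on_subset (Icc_subset_Icc_left hc.1)) huc
  have hG := intervalIntegrable_blissRatio_rpow_div (r := r) hp.le (by linarith) ha
    (hc.1.trans hc.2) hf
  rw [intervalIntegral.integral_sub (B.continuous_upper.intervalIntegrable _ _)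
      (B.continuous_lower.intervalIntegrable _ _),
    ← intervalIntegral.integral_add_adjacent_intervals hfc hfcb,
    ← intervalIntegral.integral_add_adjacent_intervals
      (hG.mono_set (uIcc_subset_uIcc_left hmc')) (hG.mono_set (uIcc_subset_uIcc_right hmc'))]
  linarith

end BlissPeak

section Bliss

variable {p r : ℝ}

theorem integral_blissRatio_rpow_div_le_of_peak {a b c s V : ℝ} {f : ℝ → ℝ}
    (B : LevelBranches (blissProfile p r) V) (hV : 0 ≤ V) (hp : 1 < p) (hr : 0 < r) (ha : 0 < a)
    (hc : c ∈ Icc a b) (hf0 : ∀ x, 0 ≤ f x) (hf : IntervalIntegrable f volume 0 b)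
    (hfp : IntervalIntegrable (fun x => f x ^ p) volume 0 b) (hs : 0 < s)
    (hmax : IsMaxOn (blissRatio p f) (Icc a b) c) (huc : blissRatio p f c = s * V) :
    (p - 1) * (1 + r) * (eulerBeta (1 / r) ((p * (1 + r) - 1) / r) / r) ^ r *
        ∫ x in a..b, blissRatio p f x ^ (1 + r) / x ≤
      (∫ x in (0 : ℝ)..b, f x ^ p) ^ (1 + r) := by
  set J := ∫ t in (0 : ℝ)..1, blissProfile p r t with hJ
  set G := ∫ x in a..b, blissRatio p f x ^ (1 + r) / x
  have hG0 : 0 ≤ G := integral_blissRatio_rpow_div_nonneg ha.le (hc.1.trans hc.2) hf0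
  have hprofile0 (t : ℝ) (ht : t ∈ Icc (0 : ℝ) 1) : 0 ≤ blissProfile p r t :=
    Real.rpow_nonneg (sub_rpow_nonneg (one_lt_div_sub_one hp).le ht) _
  have hJ0 : 0 ≤ J := intervalIntegral.integral_nonneg zero_le_one hprofile0
  have hJB := B.integral_le_integral_upper_sub_lower (continuous_blissProfile hp hr).continuousOn
    hprofile0 hV
  have hsum : (p - 1) / s ^ r * G + s * J ≤ ∫ x in (0 : ℝ)..b, f x ^ p := by
    have := calibration_levelBranches_le_integral_rpow B hp hr ha hc hf0 hf hfp hs hmax huc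
    have := mul_le_mul_of_nonneg_left hJB hs.le
    linarith
  calc (p - 1) * (1 + r) * (eulerBeta (1 / r) ((p * (1 + r) - 1) / r) / r) ^ r * G
      = (1 + r) * ((p - 1) / s ^ r * G) * ((1 + r) * (s * J) / r) ^ r := by
        rw [← integral_blissProfile hp hr, ← hJ, show (1 + r) * (s * J) / r = s * ((1 + r) * J / r)
          by ring, Real.mul_rpow hs.le (by positivity)]
        field_simp
    _ ≤ ((p - 1) / s ^ r * G + s * J) ^ (1 + r) :=
        mul_rpow_le_add_rpow hr (by positivity) (by positivity)
    _ ≤ (∫ x in (0 : ℝ)..b, f x ^ p) ^ (1 + r) := by gcongr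

theorem integral_blissRatio_rpow_div_le {a b : ℝ} {f : ℝ → ℝ} (hp : 1 < p) (hr : 0 < r)
    (ha : 0 < a) (hab : a ≤ b) (hf0 : ∀ x, 0 ≤ f x) (hf : IntervalIntegrable f volume 0 b)
    (hfp : IntervalIntegrable (fun x => f x ^ p) volume 0 b) :
    (p - 1) * (1 + r) * (eulerBeta (1 / r) ((p * (1 + r) - 1) / r) / r) ^ r *
        ∫ x in a..b, blissRatio p f x ^ (1 + r) / x ≤
      (∫ x in (0 : ℝ)..b, f x ^ p) ^ (1 + r) := by
  have hu0 {x : ℝ} (hx : x ∈ Icc a b) : 0 ≤ blissRatio p f x :=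
    blissRatio_nonneg (ha.le.trans hx.1) hf0
  have hu := (absolutelyContinuousOnInterval_blissRatio hp.le ha hab hf).continuousOn
  rw [uIcc_of_le hab] at hu
  obtain ⟨c, hc, hmax⟩ := isCompact_Icc.exists_isMaxOn (nonempty_Icc.2 hab) hu
  rcases (hu0 hc).eq_or_lt with huc | huc
  · have hzero : ∫ x in a..b, blissRatio p f x ^ (1 + r) / x = 0 := by
      refine (intervalIntegral.integral_congr fun x hx => ?_).trans intervalIntegral.integral_zero
      rw [uIcc_of_le hab] at hx
      have hux : blissRatio p f x = 0 := le_antisymm ((hmax hx).trans_eq huc.symm) (hu0 hx)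
      simp only [hux, Real.zero_rpow (by linarith : 1 + r ≠ 0), zero_div]
    rw [hzero, mul_zero]
    exact Real.rpow_nonneg (intervalIntegral.integral_nonneg (ha.le.trans hab)
      fun x _ => Real.rpow_nonneg (hf0 x) p) _
  · obtain ⟨V, hV, ⟨B⟩⟩ := exists_levelBranches_blissProfile hp hr
    exact integral_blissRatio_rpow_div_le_of_peak B hV.le hp hr ha hc hf0 hf hfp (div_pos huc hV)
      hmax (div_mul_cancel₀ _ hV.ne').symm

end Bliss

section BlissENNReal

variable {p r : ℝ}

theorem integrable_coe_of_integrable_coe_rpow {α : Type*} [MeasurableSpace α] {μ : Measure α}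
    [IsFiniteMeasure μ] {g : α → ℝ≥0} (hp : 1 ≤ p) (hg : AEMeasurable g μ)
    (hgp : Integrable (fun x => (g x : ℝ) ^ p) μ) : Integrable (fun x => (g x : ℝ)) μ := by
  refine ((integrable_const (1 : ℝ)).add hgp).mono' hg.coe_nnreal_real.aestronglyMeasurable
    (.of_forall fun x => ?_)
  rw [NNReal.norm_eq, Pi.add_apply]
  have hpow : 0 ≤ (g x : ℝ) ^ p := by positivity
  rcases le_total (g x : ℝ) 1 with hx | hx
  · linarith
  · linarith [Real.self_le_rpow_of_one_le hx hp]

theorem blissRatio_rpow_div {f : ℝ → ℝ} {x : ℝ} (hx : 0 < x) (hF : 0 ≤ ∫ t in (0 : ℝ)..x, f t) :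
    blissRatio p f x ^ (1 + r) / x =
      (∫ t in (0 : ℝ)..x, f t) ^ (p * (1 + r)) * x ^ (r - p * (1 + r)) := by
  rw [blissRatio, Real.mul_rpow (by positivity) (by positivity), ← Real.rpow_mul hF,
    ← Real.rpow_mul hx.le, mul_div_assoc, ← Real.rpow_sub_one hx.ne']
  ring_nf

theorem setLIntegral_Ioc_rpow_mul_eq {f : ℝ → ℝ≥0} {a b : ℝ} (hp : 1 ≤ p) (hr : 0 ≤ 1 + r)
    (ha : 0 < a) (hab : a ≤ b) (hf : IntegrableOn (fun x => (f x : ℝ)) (Ioc 0 b)) :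
    ∫⁻ x in Ioc a b, (∫⁻ t in Ioc 0 x, f t) ^ (p * (1 + r)) *
        ENNReal.ofReal (x ^ (r - p * (1 + r))) =
      ENNReal.ofReal (∫ x in a..b, blissRatio p (fun t => f t) x ^ (1 + r) / x) := by
  have hf' := (intervalIntegrable_iff_integrableOn_Ioc_of_le (ha.le.trans hab)).2 hf
  rw [intervalIntegral.integral_of_le hab, ofReal_integral_eq_lintegral_ofReal
    ((intervalIntegrable_iff_integrableOn_Ioc_of_le hab).1
      (intervalIntegrable_blissRatio_rpow_div hp hr ha hab hf'))]
  · refine setLIntegral_congr_fun measurableSet_Ioc fun x hx => ?_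
    have hx0 : 0 < x := ha.trans hx.1
    have hF0 : 0 ≤ ∫ t in (0 : ℝ)..x, (f t : ℝ) :=
      intervalIntegral.integral_nonneg hx0.le fun t _ => (f t).coe_nonneg
    have hF : ∫⁻ t in Ioc 0 x, (f t : ℝ≥0∞) = ENNReal.ofReal (∫ t in (0 : ℝ)..x, (f t : ℝ)) := by
      rw [intervalIntegral.integral_of_le hx0.le,
        lintegral_coe_eq_integral _ (hf.mono_set (Ioc_subset_Ioc_right hx.2))]
    simp only [hF, blissRatio_rpow_div hx0 hF0]
    rw [ENNReal.ofReal_rpow_of_nonneg hF0 (by positivity), ENNReal.ofReal_mul (by positivity)]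
  · refine (ae_restrict_iff' measurableSet_Ioc).2 (.of_forall fun x hx => ?_)
    have hx0 : 0 < x := ha.trans hx.1
    exact div_nonneg
      (Real.rpow_nonneg (blissRatio_nonneg hx0.le fun t => (f t).coe_nonneg) _) hx0.le

theorem bliss_inequality_Ioc {f : ℝ → ℝ≥0} {a b : ℝ} (hp : 1 < p) (hr : 0 < r) (ha : 0 < a)
    (hab : a ≤ b) (hf : AEMeasurable f (volume.restrict (Ioc 0 b)))
    (hfp : IntegrableOn (fun x => (f x : ℝ) ^ p) (Ioc 0 b)) :
    ENNReal.ofReal ((p - 1) * (1 + r) * (eulerBeta (1 / r) ((p * (1 + r) - 1) / r) / r) ^ r) *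
        ∫⁻ x in Ioc a b, (∫⁻ t in Ioc 0 x, f t) ^ (p * (1 + r)) *
          ENNReal.ofReal (x ^ (r - p * (1 + r))) ≤
      (∫⁻ x in Ioc 0 b, (f x : ℝ≥0∞) ^ p) ^ (1 + r) := by
  have hb0 : 0 ≤ b := ha.le.trans hab
  have hfint : IntegrableOn (fun x => (f x : ℝ)) (Ioc 0 b) :=
    integrable_coe_of_integrable_coe_rpow hp.le hf hfp
  have hright : ∫⁻ x in Ioc 0 b, (f x : ℝ≥0∞) ^ p =
      ENNReal.ofReal (∫ x in (0 : ℝ)..b, (f x : ℝ) ^ p) := by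
    rw [intervalIntegral.integral_of_le hb0]
    simpa only [ENNReal.coe_rpow_of_nonneg _ (by linarith : 0 ≤ p), NNReal.coe_rpow] using
      lintegral_coe_eq_integral (fun x => f x ^ p) hfp
  rw [setLIntegral_Ioc_rpow_mul_eq hp.le (by linarith) ha hab hfint, hright,
    ENNReal.ofReal_rpow_of_nonneg (intervalIntegral.integral_nonneg hb0 fun x _ => by positivity)
      (by linarith),
    ← ENNReal.ofReal_mul' (integral_blissRatio_rpow_div_nonneg ha.le hab fun x => (f x).coe_nonneg)]
  exact ENNReal.ofReal_le_ofReal (integral_blissRatio_rpow_div_le hp hr ha hab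
    (fun x => (f x).coe_nonneg)
    ((intervalIntegrable_iff_integrableOn_Ioc_of_le hb0).2 hfint)
    ((intervalIntegrable_iff_integrableOn_Ioc_of_le hb0).2 hfp))

theorem iUnion_Ioc_inv_natCast_add_one : ⋃ n : ℕ, Ioc ((n + 1 : ℝ)⁻¹) (n + 1) = Ioi 0 := by
  ext x
  simp only [mem_iUnion, mem_Ioc, mem_Ioi]
  refine ⟨fun ⟨n, hn, _⟩ => lt_trans (by positivity) hn, fun hx => ?_⟩
  obtain ⟨n, hn⟩ := exists_nat_gt (max x x⁻¹)
  exact ⟨n, inv_lt_of_inv_lt₀ hx (by linarith [le_max_right x x⁻¹]),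
    by linarith [le_max_left x x⁻¹]⟩

theorem bliss_inequality {f : ℝ → ℝ≥0} (hp : 1 < p) (hr : 0 < r)
    (hf : AEMeasurable f (volume.restrict (Ioi 0))) :
    ENNReal.ofReal ((p - 1) * (1 + r) * (eulerBeta (1 / r) ((p * (1 + r) - 1) / r) / r) ^ r) *
        ∫⁻ x in Ioi 0, (∫⁻ t in Ioc 0 x, f t) ^ (p * (1 + r)) *
          ENNReal.ofReal (x ^ (r - p * (1 + r))) ≤
      (∫⁻ x in Ioi 0, (f x : ℝ≥0∞) ^ p) ^ (1 + r) := by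
  rcases eq_or_ne (∫⁻ x in Ioi 0, (f x : ℝ≥0∞) ^ p) ⊤ with htop | hfin
  · rw [htop, ENNReal.top_rpow_of_pos (by linarith)]
    exact le_top
  have hfp : IntegrableOn (fun x => (f x : ℝ) ^ p) (Ioi 0) := by
    simpa only [IntegrableOn, ← ENNReal.toReal_rpow, ENNReal.coe_toReal] using
      integrable_toReal_of_lintegral_ne_top (hf.coe_nnreal_ennreal.pow_const p) hfin
  have hdir : Directed (· ⊆ ·) fun n : ℕ => Ioc ((n + 1 : ℝ)⁻¹) (n + 1) :=
    Monotone.directed_le fun m n hmn => by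
      have : (m : ℝ) ≤ n := by exact_mod_cast hmn
      exact Ioc_subset_Ioc (by gcongr) (by gcongr)
  rw [← iUnion_Ioc_inv_natCast_add_one, setLIntegral_iUnion_of_directed _ hdir, ENNReal.mul_iSup,
    iUnion_Ioc_inv_natCast_add_one]
  refine iSup_le fun n => (bliss_inequality_Ioc hp hr (by positivity)
    ((inv_le_one_of_one_le₀ ?_).trans ?_) (hf.mono_measure (Measure.restrict_mono_set _
      Ioc_subset_Ioi_self)) (hfp.mono_set Ioc_subset_Ioi_self)).trans ?_
  · linarith [n.cast_nonneg (α := ℝ)]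
  · linarith [n.cast_nonneg (α := ℝ)]
  · gcongr
    exact Ioc_subset_Ioi_self

end BlissENNReal

/-! ### The mixed inequality and its least constant -/

section StepFunction

theorem lintegral_Ioc_comp_natCeil (F : ℕ → ℝ≥0∞) (n : ℕ) :
    ∫⁻ x in Ioc (n : ℝ) ((n + 1 : ℕ) : ℝ), F ⌈x⌉₊ = F (n + 1) := by
  have hceil : EqOn (fun x : ℝ => F ⌈x⌉₊) (fun _ => F (n + 1)) (Ioc (n : ℝ) ((n + 1 : ℕ) : ℝ)) :=
    fun x hx => congrArg F ((Nat.ceil_eq_iff n.succ_ne_zero).2 hx)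
  rw [setLIntegral_congr_fun measurableSet_Ioc hceil]
  simp

theorem lintegral_Ioi_comp_natCeil (F : ℕ → ℝ≥0∞) :
    ∫⁻ x in Ioi (0 : ℝ), F ⌈x⌉₊ = ∑' n : ℕ, F (n + 1) := by
  have h := lintegral_Ioi_eq_tsum (u := fun n : ℕ => (n : ℝ)) Nat.mono_cast
    (not_bddAbove_range_natCast_add 0) fun x => F ⌈x⌉₊
  simpa only [lintegral_Ioc_comp_natCeil, Nat.cast_zero] using h

theorem sum_Ico_natCeil_le_lintegral (F : ℕ → ℝ≥0∞) (x : ℝ) :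
    ∑ n ∈ Finset.Ico 1 ⌈x⌉₊, F n ≤ ∫⁻ t in Ioc (0 : ℝ) x, F ⌈t⌉₊ := by
  rcases hN : ⌈x⌉₊ with _ | N
  · simp
  have hNx : (N : ℝ) ≤ x := (Nat.lt_ceil.1 (hN ▸ N.lt_succ_self)).le
  calc
    _ = ∑ n ∈ Finset.range N, F (n + 1) := by
      rw [Finset.sum_Ico_eq_sum_range, Nat.add_sub_cancel]
      simp only [add_comm]
    _ = ∫⁻ t in Ioc ((0 : ℕ) : ℝ) N, F ⌈t⌉₊ := by
      rw [lintegral_Ioc_eq_sum (u := fun n : ℕ => (n : ℝ)) Nat.mono_cast]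
      simp only [lintegral_Ioc_comp_natCeil]
    _ ≤ _ := by
      rw [Nat.cast_zero]
      exact lintegral_mono_set (Ioc_subset_Ioc_right hNx)

end StepFunction

theorem image_rpow_Ioi_one {c : ℝ} (hc : 0 < c) : (fun x : ℝ => x ^ c) '' Ioi 1 = Ioi 1 := by
  refine (image_subset_iff.2 fun x hx => Real.one_lt_rpow hx hc).antisymm fun y hy => ?_
  have hy0 : 0 ≤ y := zero_le_one.trans (le_of_lt hy)
  exact ⟨y ^ c⁻¹, Real.one_lt_rpow hy (inv_pos.2 hc), Real.rpow_inv_rpow hy0 hc.ne'⟩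

/- Up to normalization these are the means of `S` for two Pareto laws, and `x ↦ x ^ (β / α)` pushes
the one with exponent `β` forward to the one with exponent `α`. -/
theorem ofReal_mul_lintegral_mul_rpow_le {S : ℝ → ℝ≥0∞} (hS : MonotoneOn S (Ioi 1)) {α β : ℝ}
    (hα : 0 < α) (hαβ : α ≤ β) :
    ENNReal.ofReal β * ∫⁻ x in Ioi (1 : ℝ), S x * ENNReal.ofReal (x ^ (-β - 1)) ≤
      ENNReal.ofReal α * ∫⁻ x in Ioi (1 : ℝ), S x * ENNReal.ofReal (x ^ (-α - 1)) := by
  set c := β / α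
  have hc1 : 1 ≤ c := (one_le_div hα).2 hαβ
  have hαc : α * c = β := mul_div_cancel₀ β hα.ne'
  have hsubst := lintegral_image_eq_lintegral_abs_deriv_mul measurableSet_Ioi
    (fun x (hx : 1 < x) => (Real.hasDerivAt_rpow_const
      (Or.inl (zero_lt_one.trans hx).ne')).hasDerivWithinAt)
    ((Real.rpow_left_injOn (by positivity : c ≠ 0)).mono fun x (hx : 1 < x) =>
      (zero_le_one.trans hx.le : (0 : ℝ) ≤ x))
    fun x => S x * ENNReal.ofReal (x ^ (-α - 1))
  rw [image_rpow_Ioi_one (by positivity)] at hsubst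
  rw [hsubst, ← lintegral_const_mul' _ _ ENNReal.ofReal_ne_top,
    ← lintegral_const_mul' _ _ ENNReal.ofReal_ne_top]
  refine setLIntegral_mono' measurableSet_Ioi fun x (hx : 1 < x) => ?_
  have hx0 : 0 < x := zero_lt_one.trans hx
  have hweight : α * (|c * x ^ (c - 1)| * (x ^ c) ^ (-α - 1)) = β * x ^ (-β - 1) := by
    rw [abs_of_pos (by positivity), ← Real.rpow_mul hx0.le, mul_assoc, ← Real.rpow_add hx0,
      ← mul_assoc, hαc]
    congr 2
    linear_combination -hαc
  calc
    ENNReal.ofReal β * (S x * ENNReal.ofReal (x ^ (-β - 1)))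
      = S x * ENNReal.ofReal (β * x ^ (-β - 1)) := by
      rw [ENNReal.ofReal_mul (hα.le.trans hαβ), mul_left_comm]
    _ ≤ S (x ^ c) * ENNReal.ofReal (β * x ^ (-β - 1)) := by
      gcongr
      exact hS hx (Real.one_lt_rpow hx (by positivity)) (Real.self_le_rpow_of_one_le hx.le hc1)
    _ = _ := by
      rw [← hweight, ENNReal.ofReal_mul hα.le, ENNReal.ofReal_mul (abs_nonneg _)]
      ring

section MixedHardy

variable {p r : ℝ}

theorem mixed_hardy_self (hp : 1 < p) (f : ℕ → ℝ≥0∞) :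
    ∫⁻ x in Ioi (1 : ℝ), ((ENNReal.ofReal x)⁻¹ * ∑ n ∈ Finset.Ico 1 ⌈x⌉₊, f n) ^ p ≤
      ENNReal.ofReal ((p / (p - 1)) ^ p) * ∑' n : ℕ, f (n + 1) ^ p := by
  set u : ℕ → ℝ := fun n => ((n + 1 : ℕ) : ℝ)
  have hu : Monotone u := Nat.mono_cast.comp fun _ _ h => Nat.succ_le_succ h
  have hpiece (n : ℕ) : ∫⁻ x in Ioc (u n) (u (n + 1)),
      ((ENNReal.ofReal x)⁻¹ * ∑ k ∈ Finset.Ico 1 ⌈x⌉₊, f k) ^ p ≤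
        (((n + 1 : ℕ) : ℝ≥0∞)⁻¹ * ∑ k ∈ Finset.range (n + 1), f (k + 1)) ^ p := by
    have hbound : ∀ x ∈ Ioc (u n) (u (n + 1)),
        ((ENNReal.ofReal x)⁻¹ * ∑ k ∈ Finset.Ico 1 ⌈x⌉₊, f k) ^ p ≤
          (((n + 1 : ℕ) : ℝ≥0∞)⁻¹ * ∑ k ∈ Finset.range (n + 1), f (k + 1)) ^ p := by
      intro x hx
      have hceil : ⌈x⌉₊ = n + 1 + 1 := (Nat.ceil_eq_iff (n + 1).succ_ne_zero).2 hx
      rw [hceil, Finset.sum_Ico_eq_sum_range, Nat.add_sub_cancel]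
      simp only [add_comm 1]
      gcongr
      rw [← ENNReal.ofReal_natCast]
      exact ENNReal.ofReal_le_ofReal hx.1.le
    refine (setLIntegral_mono measurable_const hbound).trans_eq ?_
    simp [u]
  have hu0 : Ioi (1 : ℝ) = Ioi (u 0) := by simp [u]
  rw [hu0, lintegral_Ioi_eq_tsum hu (not_bddAbove_range_natCast_add 1)]
  exact (ENNReal.tsum_le_tsum hpiece).trans (hardy_tsum hp fun n => f (n + 1))

theorem mixed_hardy_of_lt (hp : 1 < p) (hr : 0 < r) (f : ℕ → ℝ≥0) :
    ENNReal.ofReal ((p * (1 + r) - 1) * (eulerBeta (1 / r) ((p * (1 + r) - 1) / r) / r) ^ r) *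
        ∫⁻ x in Ioi (1 : ℝ),
          ((ENNReal.ofReal x)⁻¹ * ∑ n ∈ Finset.Ico 1 ⌈x⌉₊, (f n : ℝ≥0∞)) ^ (p * (1 + r)) ≤
      (∑' n : ℕ, (f (n + 1) : ℝ≥0∞) ^ p) ^ (1 + r) := by
  set q := p * (1 + r) with hq
  have hq1 : 1 < q := by rw [hq]; nlinarith
  set K := (eulerBeta (1 / r) ((q - 1) / r) / r) ^ r
  set S : ℝ → ℝ≥0∞ := fun x => (∑ n ∈ Finset.Ico 1 ⌈x⌉₊, (f n : ℝ≥0∞)) ^ q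
  have hS : Monotone S := fun x y hxy => by
    dsimp only [S]
    gcongr
  have hαβ : (p - 1) * (1 + r) ≤ q - 1 := by rw [hq]; linarith
  have hα : -((p - 1) * (1 + r)) - 1 = r - q := by rw [hq]; ring
  have hintegrand : EqOn
      (fun x => ((ENNReal.ofReal x)⁻¹ * ∑ n ∈ Finset.Ico 1 ⌈x⌉₊, (f n : ℝ≥0∞)) ^ q)
      (fun x => S x * ENNReal.ofReal (x ^ (-(q - 1) - 1))) (Ioi 1) := fun x hx => by
    dsimp only [S]
    rw [ENNReal.mul_rpow_of_nonneg _ _ (by linarith), ofReal_inv_rpow (zero_lt_one.trans hx),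
      mul_comm, neg_sub, sub_sub_cancel_left]
  have hK : 0 ≤ K := by
    have := eulerBeta_pos (a := 1 / r) (b := (q - 1) / r) (by positivity)
      (div_pos (by linarith) hr)
    positivity
  calc
    _ = ENNReal.ofReal K * (ENNReal.ofReal (q - 1) *
          ∫⁻ x in Ioi (1 : ℝ), S x * ENNReal.ofReal (x ^ (-(q - 1) - 1))) := by
      rw [setLIntegral_congr_fun measurableSet_Ioi hintegrand, mul_comm (q - 1),
        ENNReal.ofReal_mul hK, mul_assoc]
    _ ≤ ENNReal.ofReal K * (ENNReal.ofReal ((p - 1) * (1 + r)) *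
          ∫⁻ x in Ioi (1 : ℝ), S x * ENNReal.ofReal (x ^ (r - q))) := by
      rw [← hα]
      gcongr ENNReal.ofReal K * ?_
      exact ofReal_mul_lintegral_mul_rpow_le (hS.monotoneOn _) (by positivity) hαβ
    _ ≤ ENNReal.ofReal ((p - 1) * (1 + r) * K) * ∫⁻ x in Ioi (0 : ℝ),
          (∫⁻ t in Ioc 0 x, (f ⌈t⌉₊ : ℝ≥0∞)) ^ q * ENNReal.ofReal (x ^ (r - q)) := by
      rw [← mul_assoc, mul_comm ((p - 1) * (1 + r)), ENNReal.ofReal_mul hK]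
      gcongr with x
      · exact zero_le_one
      · exact ENNReal.rpow_le_rpow (sum_Ico_natCeil_le_lintegral _ x) (by linarith)
    _ ≤ (∫⁻ x in Ioi (0 : ℝ), (f ⌈x⌉₊ : ℝ≥0∞) ^ p) ^ (1 + r) :=
      bliss_inequality hp hr ((measurable_from_nat.comp Nat.measurable_ceil).aemeasurable)
    _ = _ := by rw [lintegral_Ioi_comp_natCeil fun n => (f n : ℝ≥0∞) ^ p]

end MixedHardy

section LeastConstant

variable {p q : ℝ}

theorem isLeast_sInf_setOf_le_mul {ι : Type*} {L R : ι → ℝ≥0∞}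
    (hne : {A : ℝ≥0 | ∀ i, L i ≤ A * R i}.Nonempty)
    (hpos : sInf {A : ℝ≥0 | ∀ i, L i ≤ A * R i} ≠ 0) :
    IsLeast {A : ℝ≥0 | ∀ i, L i ≤ A * R i} (sInf {A : ℝ≥0 | ∀ i, L i ≤ A * R i}) := by
  refine ⟨fun i => ?_, fun A hA => csInf_le (OrderBot.bddBelow _) hA⟩
  obtain ⟨A, -, hlim, hA⟩ := exists_seq_tendsto_sInf hne (OrderBot.bddBelow _)
  exact ge_of_tendsto' (ENNReal.Tendsto.mul_const (ENNReal.tendsto_coe.2 hlim)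
    (Or.inl (ENNReal.coe_ne_zero.2 hpos))) fun n => hA n i

theorem lintegral_Ioi_inv_rpow (hq : 1 < q) :
    ∫⁻ x in Ioi (1 : ℝ), (ENNReal.ofReal x)⁻¹ ^ q = ENNReal.ofReal (q - 1)⁻¹ := by
  rw [setLIntegral_congr_fun measurableSet_Ioi
      (fun x hx => ofReal_inv_rpow (one_pos.trans hx) q),
    ← ofReal_integral_eq_lintegral_ofReal
      (integrableOn_Ioi_rpow_of_lt (by linarith) one_pos)
      (ae_restrict_of_forall_mem measurableSet_Ioi fun x hx =>
        Real.rpow_nonneg (one_pos.trans hx).le _),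
    integral_Ioi_rpow_of_lt (by linarith) one_pos, Real.one_rpow, neg_div,
    ← one_div_neg_eq_neg_one_div, one_div, neg_add, neg_neg, ← sub_eq_add_neg]

theorem le_of_mem_mixedHardyConstants (hp : 0 < p) (hq : 1 < q) {A : ℝ≥0}
    (hA : A ∈ mixedHardyConstants p q) : (q - 1) ^ (-1 / q) ≤ (A : ℝ) := by
  have hq' : 0 < q - 1 := by linarith
  have hlhs : ∫⁻ x in Ioi (1 : ℝ), ((ENNReal.ofReal x)⁻¹ *
      ∑ n ∈ Finset.Ico 1 ⌈x⌉₊, ((Pi.single 1 1 : ℕ → ℝ≥0) n : ℝ≥0∞)) ^ q =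
      ENNReal.ofReal (q - 1)⁻¹ := by
    rw [← lintegral_Ioi_inv_rpow hq]
    refine setLIntegral_congr_fun measurableSet_Ioi fun x hx => ?_
    have hmem : 1 ∈ Finset.Ico 1 ⌈x⌉₊ := by simpa [Nat.lt_ceil] using hx
    rw [Finset.sum_eq_single_of_mem 1 hmem fun n _ hn => by simp [hn]]
    simp
  have hrhs : ∑' n : ℕ, ((Pi.single 1 1 : ℕ → ℝ≥0) (n + 1) : ℝ≥0∞) ^ p = 1 := by
    rw [tsum_eq_single 0 fun n hn => by simp [hn, hp]]
    simp
  have h := hA (Pi.single 1 1)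
  rw [hlhs, hrhs, ENNReal.one_rpow, mul_one,
    ENNReal.ofReal_rpow_of_nonneg (by positivity) (by positivity)] at h
  rw [neg_div, Real.rpow_neg hq'.le, ← Real.inv_rpow hq'.le]
  exact (ENNReal.ofReal_le_iff_le_toReal ENNReal.coe_ne_top).1 h

theorem isLeast_sInf_mixedHardyConstants (hp : 0 < p) (hq : 1 < q)
    (hne : (mixedHardyConstants p q).Nonempty) :
    IsLeast (mixedHardyConstants p q) (sInf (mixedHardyConstants p q)) := by
  have hlower : Real.toNNReal ((q - 1) ^ (-1 / q)) ≤ sInf (mixedHardyConstants p q) :=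
    le_csInf hne fun A hA => Real.toNNReal_le_iff_le_coe.2 (le_of_mem_mixedHardyConstants hp hq hA)
  exact isLeast_sInf_setOf_le_mul hne ((Real.toNNReal_pos.2 (by positivity)).trans_le hlower).ne'

theorem toNNReal_rpow_mem_mixedHardyConstants (hq : 0 < q) {C : ℝ} (hC : 0 ≤ C)
    (h : ∀ f : ℕ → ℝ≥0, ∫⁻ x in Ioi (1 : ℝ),
      ((ENNReal.ofReal x)⁻¹ * ∑ n ∈ Finset.Ico 1 ⌈x⌉₊, (f n : ℝ≥0∞)) ^ q ≤
        ENNReal.ofReal C * (∑' n : ℕ, (f (n + 1) : ℝ≥0∞) ^ p) ^ (q / p)) :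
    Real.toNNReal (C ^ (1 / q)) ∈ mixedHardyConstants p q := by
  intro f
  refine (ENNReal.rpow_le_rpow (h f) (by positivity)).trans_eq ?_
  rw [ENNReal.mul_rpow_of_nonneg _ _ (by positivity), ← ENNReal.rpow_mul,
    ENNReal.ofReal_rpow_of_nonneg hC (by positivity), div_mul_div_cancel₀' hq.ne']
  rfl

theorem hardyFactor_self_mul_rpow (hp : 1 < p) :
    hardyFactor p p * (p - 1) ^ (-1 / p) = ((p / (p - 1)) ^ p) ^ (1 / p) := by
  have hp0 : 0 < p := by linarith
  have hp' : 0 < p - 1 := by linarith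
  rw [hardyFactor, if_pos rfl, ← Real.rpow_mul (by positivity), mul_one_div_cancel hp0.ne',
    Real.rpow_one, Real.rpow_sub (by positivity), Real.rpow_one, Real.div_rpow hp0.le hp'.le,
    neg_div, Real.rpow_neg hp'.le]
  field_simp

theorem hardyFactor_mul_rpow_of_lt {r : ℝ} (hp : 1 < p) (hr : 0 < r) :
    hardyFactor (p * (1 + r)) p * (p * (1 + r) - 1) ^ (-1 / (p * (1 + r))) =
      ((p * (1 + r) - 1) * (eulerBeta (1 / r) ((p * (1 + r) - 1) / r) / r) ^ r)⁻¹ ^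
        (1 / (p * (1 + r))) := by
  have hq' : 0 < p * (1 + r) - 1 := by nlinarith
  have hB : 0 < eulerBeta (1 / r) ((p * (1 + r) - 1) / r) :=
    eulerBeta_pos (by positivity) (by positivity)
  have hpq : p ≠ p * (1 + r) := by nlinarith
  have hratio : p * (1 + r) / p - 1 = r := by field_simp; ring
  have hexp : 1 / p - 1 / (p * (1 + r)) = r * (1 / (p * (1 + r))) := by field_simp; ring
  rw [hardyFactor, if_neg hpq, hratio, hexp, Real.rpow_mul (by positivity), mul_inv, mul_comm,
    Real.mul_rpow (by positivity) (by positivity), ← Real.inv_rpow (by positivity), inv_div,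
    neg_div, Real.rpow_neg hq'.le, ← Real.inv_rpow hq'.le]

theorem toNNReal_hardyFactor_mul_mem (hp : 1 < p) (hpq : p ≤ q) :
    Real.toNNReal (hardyFactor q p * (q - 1) ^ (-1 / q)) ∈ mixedHardyConstants p q := by
  have hp0 : 0 < p := by linarith
  rcases hpq.eq_or_lt with rfl | hlt
  · rw [hardyFactor_self_mul_rpow hp]
    refine toNNReal_rpow_mem_mixedHardyConstants hp0 (by positivity) fun f => ?_
    simpa only [div_self hp0.ne', ENNReal.rpow_one] using mixed_hardy_self hp fun n => (f n : ℝ≥0∞)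
  · obtain ⟨r, hr, rfl⟩ : ∃ r, 0 < r ∧ q = p * (1 + r) :=
      ⟨q / p - 1, sub_pos.2 ((one_lt_div hp0).2 hlt), by field_simp; ring⟩
    have hq' : 0 < p * (1 + r) - 1 := by linarith
    have hB : 0 < eulerBeta (1 / r) ((p * (1 + r) - 1) / r) :=
      eulerBeta_pos (by positivity) (by positivity)
    rw [hardyFactor_mul_rpow_of_lt hp hr]
    refine toNNReal_rpow_mem_mixedHardyConstants (by positivity) (by positivity) fun f => ?_
    rw [ENNReal.ofReal_inv_of_pos (by positivity), mul_div_cancel_left₀ _ hp0.ne',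
      ← ENNReal.mul_le_iff_le_inv (by positivity) ENNReal.ofReal_ne_top]
    exact mixed_hardy_of_lt hp hr f

end LeastConstant

theorem corollary1p4 :
    (∀ (p : ℝ), 1 < p → ∀ f : ℝ → ℝ≥0, AEMeasurable f (volume.restrict (Ici (1 : ℝ))) →
      ∑' n : ℕ, (((n + 1 : ℕ) : ℝ≥0∞)⁻¹ *
          ∫⁻ t in Ioc (1 : ℝ) ((n + 1 : ℕ) : ℝ), (f t : ℝ≥0∞)) ^ p
        ≤ ENNReal.ofReal ((p / (p - 1)) ^ p) * ∫⁻ x in Ioi (1 : ℝ), (f x : ℝ≥0∞) ^ p) ∧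
    (∀ (p q : ℝ), 1 < p → p ≤ q →
      ∃ A : ℝ≥0, IsLeast (mixedHardyConstants p q) A ∧
        (q - 1) ^ (-1 / q) ≤ (A : ℝ) ∧ (A : ℝ) ≤ hardyFactor q p * (q - 1) ^ (-1 / q)) := by
  refine ⟨fun p hp f hf => hardy_sum_integral hp ?_, fun p q hp hpq => ?_⟩
  · exact (hf.mono_measure (Measure.restrict_mono Ioi_subset_Ici_self le_rfl)).coe_nnreal_ennreal
  · have hp0 : 0 < p := by linarith
    have hq : 1 < q := hp.trans_le hpq
    have hq' : 0 < q - 1 := by linarith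
    have hmem := toNNReal_hardyFactor_mul_mem hp hpq
    have hleast := isLeast_sInf_mixedHardyConstants hp0 hq ⟨_, hmem⟩
    have hlower := le_of_mem_mixedHardyConstants hp0 hq hleast.1
    have hpos : 0 < sInf (mixedHardyConstants p q) :=
      NNReal.coe_pos.1 ((Real.rpow_pos_of_pos hq' _).trans_le hlower)
    exact ⟨_, hleast, hlower, (Real.le_toNNReal_iff_coe_le' hpos).1 (hleast.2 hmem)⟩
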